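/- Let $\mathcal{A}$ be a complex unital Banach algebra that is semisimple (its Jacobson radical is $\{0\}$), and let $\mathrm{soc}(\mathcal{A})$ be its socle, the sum of all minimal right ideals of $\mathcal{A}$ ($\{0\}$ if there are none); it is a two-sided ideal. An element $a$ of a ring is Drazin invertible, with Drazin inverse $b$, if $bab=b$, $ab=ba$ and $a^{k}ba=a^{k}$ for some $k\in\mathbb{N}$. Let $\pi:\mathcal{A}\to\mathcal{A}/\mathrm{soc}(\mathcal{A})$ be the quotient map. An element $a\in\mathcal{A}$ is - *Riesz* if its class in $\mathcal{A}/\overline{\mathrm{soc}(\mathcal{A})}$ is quasinilpotent (has spectral radius $0$); - *B-Fredholm* if $\pi(a)$ is Drazin invertible in $\mathcal{A}/\mathrm{soc}(\mathcal{A})$; - *B-Weyl* if it is B-Fredholm of index $0$, where the index of a B-Fredholm element $a$ is $\tau(aa_{0}-a_{0}a)$ for any $a_{0}\in\mathcal{A}$ such that $\pi(a_{0})$ is a Drazin inverse of $\pi(a)$ (the value does not depend on $a_0$). Here $\tau(s)=\sum_{\lambda\in\sigma(s)}\lambda\, m(\lambda,s)$ for $s\in\mathrm{soc}(\mathcal{A})$,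 where for $\lambda\neq 0$ the algebraic multiplicity $m(\lambda,s)$ is the least number of minimal right ideals of $\mathcal{A}$ whose sum is $\bigcup_{k}\{x\in\mathcal{A}:(s-\lambda)^{k}x=0\}$. Then for every $f\in\mathcal{A}$ the following statements are equivalent: 1. $f^{n}\in\mathrm{soc}(\mathcal{A})$ for some $n\in\mathbb{N}$; 2. $f$ is Riesz and Drazin invertible in $\mathcal{A}$; 3. $f$ is Riesz and B-Weyl; 4. $f$ is Riesz and B-Fredholm. -/

import Mathlib

open scoped MulOpposite

/-! Right ideals of a ring `A` are the `Aᵐᵒᵖ`-submodules of `A`; the minimal ones are the atoms of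
the lattice of right ideals. -/

section Socle

variable (A : Type*) [Ring A]

/-- The sum of all minimal right ideals of `A` (it is `0` if there are none), as a right ideal. -/
def rightSocle : Submodule Aᵐᵒᵖ A :=
  sSup {J : Submodule Aᵐᵒᵖ A | IsAtom J}

variable {A}

/-- Left multiplication by `a`, as a homomorphism of right `A`-modules. -/
def mulLeftHom (a : A) : A →ₗ[Aᵐᵒᵖ] A where
  toFun x := a * x
  map_add' x y := mul_add a x y
  map_smul' r x := by simp [MulOpposite.smul_eq_mul_unop, mul_assoc]

theorem mul_mem_rightSocle (a : A) {x : A} (hx : x ∈ rightSocle A) : a * x ∈ rightSocle A := by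
  have key : (rightSocle A).map (mulLeftHom a) ≤ rightSocle A := by
    unfold rightSocle
    rw [sSup_eq_iSup, Submodule.map_iSup]
    refine iSup_le fun J => ?_
    rw [Submodule.map_iSup]
    refine iSup_le fun hJ => ?_
    have hJ' : IsSimpleModule Aᵐᵒᵖ J := isSimpleModule_iff_isAtom.mpr hJ
    by_cases h0 : J.map (mulLeftHom a) = ⊥
    · rw [h0]; exact bot_le
    · have hinj : Function.Injective ((mulLeftHom a).submoduleMap J) := by
        rcases LinearMap.injective_or_eq_zero ((mulLeftHom a).submoduleMap J) with h | h
        · exact h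
        · exfalso
          apply h0
          rw [eq_bot_iff]
          rintro _ ⟨y, hy, rfl⟩
          have := congrArg (fun g => ((g ⟨y, hy⟩ : J.map (mulLeftHom a)) : A)) h
          simpa using this
      have e := LinearEquiv.ofBijective ((mulLeftHom a).submoduleMap J)
        ⟨hinj, (mulLeftHom a).submoduleMap_surjective J⟩
      have : IsSimpleModule Aᵐᵒᵖ (J.map (mulLeftHom a)) := IsSimpleModule.congr e.symm
      exact le_iSup₂_of_le (J.map (mulLeftHom a)) (isSimpleModule_iff_isAtom.mp this) le_rfl
  exact key ⟨x, hx, rfl⟩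

variable (A)

/-- The socle of `A`: the sum of the minimal right ideals. It is a two-sided ideal. -/
def soc : Ideal A where
  carrier := {x | x ∈ rightSocle A}
  add_mem' := fun hx hy => (rightSocle A).add_mem hx hy
  zero_mem' := (rightSocle A).zero_mem
  smul_mem' := fun a _ hx => mul_mem_rightSocle a hx

instance soc_isTwoSided : (soc A).IsTwoSided :=
  ⟨fun b hx => (rightSocle A).smul_mem (MulOpposite.op b) hx⟩

end Socle

section Drazin

variable {R : Type*} [Ring R]

/-- `b` is a Drazin inverse of `a`. -/
def IsDrazinInverse (a b : R) : Prop :=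
  b * a * b = b ∧ a * b = b * a ∧ ∃ k : ℕ, a ^ k * b * a = a ^ k

/-- `a` is Drazin invertible in the ring `R`. -/
def IsDrazinInvertible (a : R) : Prop := ∃ b : R, IsDrazinInverse a b

/-- `a` is a B-Fredholm element: its class is Drazin invertible in the quotient by the socle. -/
def IsBFredholm (a : R) : Prop := IsDrazinInvertible (Ideal.Quotient.mk (soc R) a)

end Drazin

section Order

variable {A : Type*} [Ring A]

/-- The order of a right ideal `J`: the least number of minimal right ideals with sum `J`, and `∞`
if `J` is not a finite sum of minimal right ideals. The zero ideal is the empty sum. -/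
noncomputable def rightOrder (J : Submodule Aᵐᵒᵖ A) : ℕ∞ :=
  sInf {n : ℕ∞ | ∃ s : Finset (Submodule Aᵐᵒᵖ A),
    (∀ I ∈ s, IsAtom I) ∧ s.sup id = J ∧ n = s.card}

/-- The right annihilator `{x | a * x = 0}` of `a`, a right ideal. -/
def rightAnnihilator (a : A) : Submodule Aᵐᵒᵖ A := LinearMap.ker (mulLeftHom a)

/-- The algebraic multiplicity of `z` for `a`: the order of the generalized null right ideal
`{x | (a - z) ^ k * x = 0 for some k}` (an increasing union of right ideals). For `a` in the socle
of a semisimple Banach algebra and `z ≠ 0` this right ideal is `p A`, with `p` the spectral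
idempotent of `a` at `z`, so that the multiplicity is the rank of `p`, a natural number. -/
noncomputable def algMultiplicity [Algebra ℂ A] (z : ℂ) (a : A) : ℕ∞ :=
  rightOrder (⨆ k : ℕ, rightAnnihilator ((a - algebraMap ℂ A z) ^ k))

/-- The trace: the sum of the spectral values, each counted with its algebraic multiplicity.
It is used only for elements of the socle; those have finite spectrum, and `z = 0` contributes `0`
whatever its multiplicity is. -/
noncomputable def socTrace [Algebra ℂ A] (a : A) : ℂ :=
  ∑ᶠ z ∈ spectrum ℂ a, z * ((algMultiplicity z a).toNat : ℂ)

/-- The B-Fredholm index of `a` is `z`: the trace of `a * a₀ - a₀ * a` is `z` for every `a₀` whose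
class is a Drazin inverse of the class of `a` modulo the socle. -/
def HasBFredholmIndex [Algebra ℂ A] (a : A) (z : ℂ) : Prop :=
  ∀ a₀ : A, IsDrazinInverse (Ideal.Quotient.mk (soc A) a) (Ideal.Quotient.mk (soc A) a₀) →
    socTrace (a * a₀ - a₀ * a) = z

/-- `a` is a B-Weyl element: it is B-Fredholm of index zero. -/
def IsBWeyl [Algebra ℂ A] (a : A) : Prop := IsBFredholm a ∧ HasBFredholmIndex a 0

end Order

section Riesz

variable {A : Type*} [NormedRing A]

instance closure_soc_isTwoSided : (soc A).closure.IsTwoSided where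
  mul_mem_of_left b hx :=
    map_mem_closure (f := fun y : A => y * b) (continuous_mul_const b) hx
      fun _ hy => (soc A).mul_mem_right b hy

/-- `a` is a Riesz element: its class in the quotient by the closure of the socle is quasinilpotent,
that is, has spectral radius zero. -/
def IsRiesz [NormedAlgebra ℂ A] (a : A) : Prop :=
  spectralRadius ℂ (Ideal.Quotient.mk (soc A).closure a) = 0

end Riesz

/-! ### Finite length and Drazin inverses. -/

section FiniteLength

variable {A : Type*} [Ring A]

/-! A power of `f` in the socle generates a right ideal of finite length, where the ranges and
kernels of the powers of left multiplication by `f` stabilize, as in Fitting's lemma; this yields a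
Drazin inverse (`isDrazinInvertible_of_pow_mem_soc`). Modulo the closed socle `f` is nilpotent,
hence Riesz.

Conversely, let `g` represent a Drazin inverse of a Riesz element `f` modulo the socle. Then `f * g`
is idempotent modulo the socle, and modulo the closure it is a quasinilpotent times a commuting
element, hence zero. An element of the closure of an ideal that is idempotent modulo the ideal lies
in it (`mem_of_mem_closure`), so `f * g`, and with it some `f ^ k`, is in the socle.

The index takes most of the work. If `f` is nilpotent modulo the socle, its Drazin inverse there is
zero, so every lift `g` is in the socle and `socTrace (f * g - g * f) = 0` is needed. Since
`socTrace` is defined by multiplicities, it is compared with linear algebra. For a minimal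
idempotent `e` the corner `e A e` is `ℂ e`, so `J e` is finite-dimensional when `J` lies in a finite
sum of minimal right ideals. With one `e` per isomorphism class, these dimensions add up to the
order of `J` (`rightOrder_eq_dimSum`). Hence `socTrace` is a sum of ordinary traces
(`socTrace_eq_sum_trace`), and these vanish on the commutator. -/

theorem mulLeftHom_apply (a x : A) : mulLeftHom a x = a * x := rfl

theorem mul_right_mem {J : Submodule Aᵐᵒᵖ A} {x : A} (hx : x ∈ J) (a : A) : x * a ∈ J :=
  J.smul_mem (MulOpposite.op a) hx

/-- Every element of the socle lies in a finite sum of minimal right ideals. -/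
theorem exists_finset_of_mem_soc {x : A} (hx : x ∈ soc A) :
    ∃ s : Finset (Submodule Aᵐᵒᵖ A), (∀ I ∈ s, IsAtom I) ∧ x ∈ s.sup id := by
  have hx' : x ∈ sSup {J : Submodule Aᵐᵒᵖ A | IsAtom J} := hx
  rw [Submodule.mem_sSup_iff_exists_finset] at hx'
  obtain ⟨s, hs, hx⟩ := hx'
  refine ⟨s, fun I hI => hs hI, ?_⟩
  rwa [Finset.sup_id_eq_sSup, sSup_eq_iSup]

theorem isArtinian_and_isNoetherian_finset_sup (s : Finset (Submodule Aᵐᵒᵖ A))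
    (hs : ∀ I ∈ s, IsAtom I) :
    IsArtinian Aᵐᵒᵖ (s.sup id : Submodule Aᵐᵒᵖ A) ∧
      IsNoetherian Aᵐᵒᵖ (s.sup id : Submodule Aᵐᵒᵖ A) := by
  classical
  induction s using Finset.induction_on with
  | empty => rw [Finset.sup_empty]; exact ⟨inferInstance, inferInstance⟩
  | insert I s _ ih =>
    rw [Finset.sup_insert]
    obtain ⟨h1, h2⟩ := ih fun I hI => hs I (Finset.mem_insert_of_mem hI)
    have : IsSimpleModule Aᵐᵒᵖ I := isSimpleModule_iff_isAtom.mpr (hs I (by simp))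
    exact ⟨isArtinian_sup I _, isNoetherian_sup I _⟩

/-- If left multiplication by `f` has a stable range and a stable kernel from the exponent `m` on,
then `f` is Drazin invertible. -/
theorem isDrazinInvertible_of_stable {f : A} {m : ℕ} {w : A} (hw : f ^ (2 * m + 1) * w = f ^ m)
    (hker : ∀ z, f ^ (2 * m + 1) * z = 0 → f ^ m * z = 0) : IsDrazinInvertible f := by
  have hfb : f ^ (m + 1) * (f ^ m * w) = f ^ m := by
    rw [← mul_assoc, ← pow_add, ← hw]; congr 2; ring
  -- Left multiplication by `f ^ (m + 1)` is injective on `f ^ m A`; each identity for `b` is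
  -- checked after this multiplication.
  have key : ∀ z, f ^ (m + 1) * (f ^ m * z) = 0 → f ^ m * z = 0 := fun z hz => hker z <| by
    rw [← hz, ← mul_assoc, ← pow_add]; congr 2; ring
  have hcomm : f * (f ^ m * w) = f ^ m * w * f := by
    have h := key (f * w - w * f) <| by
      have h1 : f ^ m * (f * w - w * f) = f * (f ^ m * w) - f ^ m * w * f := by
        rw [mul_sub, ← mul_assoc, ← mul_assoc, ← mul_assoc, ← pow_succ, ← pow_succ']
      rw [h1, mul_sub, ← mul_assoc (f ^ (m + 1)) f, ← pow_succ, pow_succ', mul_assoc f, hfb,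
        ← mul_assoc (f ^ (m + 1)), hfb, ← pow_succ, ← pow_succ', sub_self]
    rw [mul_sub, ← mul_assoc, ← pow_succ, pow_succ', mul_assoc, ← mul_assoc (f ^ m), sub_eq_zero]
      at h
    exact h
  set b := f ^ m * w with hb
  refine ⟨b, ?_, hcomm, m, ?_⟩
  · have h1 : f ^ m * (w * (f * b) - w) = b * (f * b) - b := by
      rw [mul_sub, ← mul_assoc, ← hb]
    have h := key (w * (f * b) - w) <| by
      rw [h1, mul_sub, ← mul_assoc, hfb, ← mul_assoc, ← pow_succ, hfb, sub_self]
    rwa [h1, sub_eq_zero, ← mul_assoc] at h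
  · rw [mul_assoc, ← hcomm, ← mul_assoc, ← pow_succ, hfb]

theorem isDrazinInvertible_of_pow_mem_soc {f : A} {n : ℕ} (hf : f ^ n ∈ soc A) :
    IsDrazinInvertible f := by
  obtain ⟨s, hs, hfs⟩ := exists_finset_of_mem_soc hf
  obtain ⟨h1, h2⟩ := isArtinian_and_isNoetherian_finset_sup s hs
  set R : Submodule Aᵐᵒᵖ A := LinearMap.range (mulLeftHom (f ^ n)) with hR
  have hle : R ≤ s.sup id := by
    rintro _ ⟨x, rfl⟩
    exact mul_right_mem hfs x
  have : IsArtinian Aᵐᵒᵖ R := isArtinian_of_le hle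
  have : IsNoetherian Aᵐᵒᵖ R :=
    isNoetherian_of_injective (Submodule.inclusion hle) (Submodule.inclusion_injective hle)
  have hmaps : ∀ x ∈ R, mulLeftHom f x ∈ R := by
    rintro _ ⟨x, rfl⟩
    refine ⟨f * x, ?_⟩
    simp only [mulLeftHom_apply]
    rw [← mul_assoc, ← mul_assoc, ← pow_succ, pow_succ']
  set g : Module.End Aᵐᵒᵖ R := (mulLeftHom f).restrict hmaps with hg
  have hgpow : ∀ (k : ℕ) (x : R), ((g ^ k) x : A) = f ^ k * x := by
    intro k
    induction k with
    | zero => simp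
    | succ k ih =>
      intro x
      rw [pow_succ, Module.End.mul_apply, ih, pow_succ, mul_assoc]
      rfl
  obtain ⟨k₁, hk₁⟩ := IsArtinian.monotone_stabilizes g.iterateRange
  obtain ⟨k₂, hk₂⟩ := monotone_stabilizes_iff_noetherian.mpr ‹_› g.iterateKer
  set k := max k₁ k₂
  have hrange : ∀ j, k ≤ j → LinearMap.range (g ^ k) = LinearMap.range (g ^ j) := fun j hj =>
    (hk₁ k (le_max_left k₁ k₂)).symm.trans (hk₁ j ((le_max_left k₁ k₂).trans hj))
  have hker : ∀ j, k ≤ j → LinearMap.ker (g ^ k) = LinearMap.ker (g ^ j) := fun j hj =>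
    (hk₂ k (le_max_right k₁ k₂)).symm.trans (hk₂ j ((le_max_right k₁ k₂).trans hj))
  have hfn : ∀ z, f ^ n * z ∈ R := fun z => ⟨z, rfl⟩
  have hfn1 : f ^ n ∈ R := ⟨1, mul_one _⟩
  -- With the factor `f ^ n` carried by elements of `R`, this exponent becomes `2 * (n + k) + 1`, as
  -- required for `m = n + k`.
  obtain ⟨⟨_, w, rfl⟩, hw⟩ : (g ^ k) ⟨f ^ n, hfn1⟩ ∈ LinearMap.range (g ^ (k + (n + k) + 1)) :=
    hrange (k + (n + k) + 1) (by omega) ▸ LinearMap.mem_range_self _ _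
  refine isDrazinInvertible_of_stable (m := n + k) (w := w) ?_ fun z hz => ?_
  · have := congrArg (Subtype.val) hw
    rw [hgpow, hgpow] at this
    simp only [mulLeftHom_apply] at this
    rw [← mul_assoc, ← pow_add, ← pow_add] at this
    rw [add_comm n k, ← this]; congr 2; ring
  · have : (⟨f ^ n * z, hfn z⟩ : R) ∈ LinearMap.ker (g ^ k) := by
      rw [hker (k + (n + k) + 1) (by omega), LinearMap.mem_ker]
      apply Subtype.ext
      rw [hgpow, ← mul_assoc, ← pow_add]
      rw [show k + (n + k) + 1 + n = 2 * (n + k) + 1 by ring, hz]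
      rfl
    have := congrArg Subtype.val (LinearMap.mem_ker.mp this)
    rw [hgpow, ← mul_assoc, ← pow_add] at this
    rw [add_comm n k, this]; rfl

end FiniteLength

/-! ### Quasinilpotent elements and the closure of the socle. -/

section Quasinilpotent

open Filter Topology ENNReal

/-- A quasinilpotent element has no commuting inverse relative to a nonzero idempotent. -/
theorem eq_zero_of_spectralRadius_eq_zero {B : Type*} [NormedRing B] [NormedAlgebra ℂ B]
    [CompleteSpace B] {x y : B} (hx : spectralRadius ℂ x = 0) (hxy : x * y = y * x)
    (he : IsIdempotentElem (x * y)) : x * y = 0 := by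
  have hpow : ∀ n : ℕ, n ≠ 0 → x * y = x ^ n * y ^ n := fun n hn => by
    rw [← (show Commute x y from hxy).mul_pow, he.pow_eq hn]
  have hlim := spectrum.pow_norm_pow_one_div_tendsto_nhds_spectralRadius x
  rw [hx] at hlim
  -- Eventually `‖x ^ n‖ ≤ ε ^ n`, so this `ε` makes `‖x ^ n‖ * ‖y‖ ^ n` at most `(1 / 2) ^ n`.
  obtain ⟨ε, hε0, hε⟩ : ∃ ε : ℝ, 0 < ε ∧ ε * ‖y‖ ≤ 1 / 2 :=
    ⟨1 / (2 * (‖y‖ + 1)), by positivity, by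
      rw [div_mul_eq_mul_div, div_le_div_iff₀ (by positivity) (by positivity)]
      nlinarith [norm_nonneg y]⟩
  have hev := hlim.eventually (gt_mem_nhds (ENNReal.ofReal_pos.mpr hε0))
  have hle : ∀ᶠ n : ℕ in atTop, ‖x * y‖ ≤ (1 / 2 : ℝ) ^ n := by
    filter_upwards [hev, eventually_ge_atTop 1] with n hn hn1
    have hn0 : n ≠ 0 := by omega
    rw [ENNReal.ofReal_lt_ofReal_iff hε0] at hn
    have hxn : ‖x ^ n‖ ≤ ε ^ n := by
      have := pow_le_pow_left₀ (by positivity) hn.le n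
      rwa [one_div, Real.rpow_inv_natCast_pow (norm_nonneg _) hn0] at this
    calc ‖x * y‖ = ‖x ^ n * y ^ n‖ := by rw [← hpow n hn0]
      _ ≤ ‖x ^ n‖ * ‖y ^ n‖ := norm_mul_le _ _
      _ ≤ ε ^ n * ‖y‖ ^ n := by
        gcongr
        exact norm_pow_le' y hn1
      _ = (ε * ‖y‖) ^ n := (mul_pow _ _ _).symm
      _ ≤ _ := by gcongr
  have h0 := ge_of_tendsto
    (tendsto_pow_atTop_nhds_zero_of_lt_one (by norm_num : (0 : ℝ) ≤ 1 / 2) (by norm_num)) hle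
  exact norm_le_zero_iff.mp h0

/-- The quotient of a normed ring by a closed two-sided ideal. -/
noncomputable abbrev quotientNormedRing {A : Type*} [NormedRing A] (I : Ideal A) [I.IsTwoSided]
    [IsClosed (I : Set A)] : NormedRing (A ⧸ I) :=
  { Ideal.Quotient.ring I, Submodule.Quotient.normedAddCommGroup I with
    norm_mul_le x y := by
      let _ := Submodule.Quotient.normedAddCommGroup I
      refine le_of_tendsto_of_tendsto (b := 𝓝[>] (0 : ℝ)) tendsto_const_nhds
        (f := fun _ => ‖x * y‖) (g := fun ε => (‖x‖ + ε) * (‖y‖ + ε)) ?_ ?_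
      · refine Tendsto.mono_left ?_ nhdsWithin_le_nhds
        have : Continuous fun ε : ℝ => (‖x‖ + ε) * (‖y‖ + ε) := by fun_prop
        simpa using this.tendsto 0
      · filter_upwards [self_mem_nhdsWithin] with ε hε
        obtain ⟨a, rfl, ha⟩ := Submodule.Quotient.norm_mk_lt x hε
        obtain ⟨b, rfl, hb⟩ := Submodule.Quotient.norm_mk_lt y hε
        calc ‖(Submodule.Quotient.mk (a * b) : A ⧸ I)‖ ≤ ‖a * b‖ :=
              Submodule.Quotient.norm_mk_le I _
          _ ≤ ‖a‖ * ‖b‖ := norm_mul_le _ _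
          _ ≤ _ := mul_le_mul ha.le hb.le (norm_nonneg _) ((norm_nonneg _).trans ha.le) }

variable {A : Type*} [NormedRing A] [CompleteSpace A]

/-- If `x` is quasinilpotent modulo a closed ideal `J` and `x * y = y * x` is idempotent modulo a
smaller ideal, then `x * y` lies in `J`. -/
theorem mem_of_isIdempotentElem_quotient [NormedAlgebra ℂ A] {I J : Ideal A} [I.IsTwoSided]
    [J.IsTwoSided] [IsClosed (J : Set A)] {x y : A} (hx : spectralRadius ℂ (Ideal.Quotient.mk J x) = 0)
    (hIJ : I ≤ J)
    (hxy : Ideal.Quotient.mk I x * Ideal.Quotient.mk I y =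
      Ideal.Quotient.mk I y * Ideal.Quotient.mk I x)
    (he : IsIdempotentElem (Ideal.Quotient.mk I x * Ideal.Quotient.mk I y)) : x * y ∈ J := by
  let _ := quotientNormedRing J
  let _ : NormedAlgebra ℂ (A ⧸ J) :=
    { norm_smul_le := (Submodule.Quotient.normedSpace J ℂ).norm_smul_le }
  have h := congrArg (Ideal.Quotient.factor hIJ) hxy
  have h' := congrArg (Ideal.Quotient.factor hIJ) he
  simp only [map_mul, Ideal.Quotient.factor_mk] at h h'
  have : CompleteSpace (A ⧸ J) := Submodule.Quotient.completeSpace J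
  have := eq_zero_of_spectralRadius_eq_zero hx h h'
  rwa [← map_mul, Ideal.Quotient.eq_zero_iff_mem] at this

/-- An element of the closure of an ideal that is idempotent modulo the ideal lies in the ideal. -/
theorem mem_of_mem_closure {I : Ideal A} [I.IsTwoSided] {p : A} (hp : p ∈ I.closure)
    (hpp : p - p * p ∈ I) : p ∈ I := by
  obtain ⟨s, hs, hps⟩ := Metric.mem_closure_iff.mp (show p ∈ closure (I : Set A) from hp) 1 one_pos
  rw [dist_eq_norm] at hps
  -- With `s` in `I` close to `p`, the unit `u = 1 - (p - s)` satisfies `p * u = (p - p * p) + p *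
  -- s`.
  obtain ⟨u, hu⟩ := isUnit_one_sub_of_norm_lt_one hps
  have h : p * u ∈ I := by
    rw [hu, show p * (1 - (p - s)) = (p - p * p) + p * s by noncomm_ring]
    exact I.add_mem hpp (I.mul_mem_left p hs)
  simpa using I.mul_mem_right (↑u⁻¹) h

theorem pow_mem_soc_of_isRiesz_of_isBFredholm [NormedAlgebra ℂ A] {f : A}
    (hf : IsRiesz f) (hB : IsBFredholm f) :
    ∃ n : ℕ, f ^ n ∈ soc A := by
  obtain ⟨b, hbab, hcomm, k, hk⟩ := hB
  obtain ⟨g, rfl⟩ := Ideal.Quotient.mk_surjective b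
  have he : IsIdempotentElem (Ideal.Quotient.mk (soc A) f * Ideal.Quotient.mk (soc A) g) := by
    unfold IsIdempotentElem
    rw [mul_assoc, ← mul_assoc _ _ (Ideal.Quotient.mk (soc A) g), hbab]
  have : IsClosed ((soc A).closure : Set A) := isClosed_closure
  have h1 : f * g ∈ (soc A).closure :=
    mem_of_isIdempotentElem_quotient hf (fun _ hx => subset_closure hx) hcomm he
  have h2 : f * g ∈ soc A := by
    refine mem_of_mem_closure h1 ?_
    rw [← Ideal.Quotient.eq_zero_iff_mem, map_sub, map_mul, map_mul, map_mul, he.eq, sub_self]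
  refine ⟨k, ?_⟩
  rw [← Ideal.Quotient.eq_zero_iff_mem] at h2 ⊢
  rw [map_pow, ← hk, mul_assoc, ← hcomm, ← map_mul, h2, mul_zero]

theorem isRiesz_of_pow_mem_soc {A : Type*} [NormedRing A] [NormedAlgebra ℂ A] {f : A}
    {n : ℕ} (hf : f ^ n ∈ soc A) : IsRiesz f := by
  have h : Ideal.Quotient.mk (soc A).closure f ^ n = 0 := by
    rw [← map_pow, Ideal.Quotient.eq_zero_iff_mem]
    exact subset_closure hf
  unfold IsRiesz spectralRadius
  refine le_antisymm (iSup₂_le fun z hz => ?_) bot_le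
  by_contra hz0
  have hz0 : z ≠ 0 := by rintro rfl; simp at hz0
  apply spectrum.mem_iff.mp hz
  have hcomm : Commute (-Ideal.Quotient.mk (soc A).closure f)
      (algebraMap ℂ (A ⧸ (soc A).closure) z) := Algebra.commute_algebraMap_right _ _
  rw [sub_eq_add_neg]
  exact IsNilpotent.isUnit_add_left_of_commute (IsNilpotent.neg ⟨n, h⟩)
    ((IsUnit.mk0 z hz0).map (algebraMap ℂ (A ⧸ (soc A).closure))) hcomm

end Quasinilpotent

/-! ### Drazin inverses in quotients. -/

section Quotient

variable {R : Type*} [Ring R]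

theorem IsDrazinInvertible.isBFredholm {a : R} (h : IsDrazinInvertible a) : IsBFredholm a := by
  obtain ⟨b, h1, h2, k, h3⟩ := h
  refine ⟨Ideal.Quotient.mk (soc R) b, ?_, ?_, k, ?_⟩
  · rw [← map_mul, ← map_mul, h1]
  · rw [← map_mul, ← map_mul, h2]
  · rw [← map_pow, ← map_mul, ← map_mul, h3]

/-- Iterating `b = b * a * b` and commuting gives `b = b * (a ^ n * b ^ n)`. -/
theorem IsDrazinInverse.eq_zero_of_pow_eq_zero {a b : R} (h : IsDrazinInverse a b) {n : ℕ}
    (hn : a ^ n = 0) : b = 0 := by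
  obtain ⟨h1, h2, -⟩ := h
  have : ∀ n : ℕ, b = b * (a ^ n * b ^ n) := by
    intro n
    induction n with
    | zero => simp
    | succ n ih =>
      have hab : Commute a b := h2
      calc b = b * a * b := h1.symm
        _ = a * b * b := by rw [h2]
        _ = a * (b * (a ^ n * b ^ n)) * b := by rw [← ih]
        _ = b * (a ^ (n + 1) * b ^ (n + 1)) := by
          rw [pow_succ' a, pow_succ b, ← mul_assoc a b, h2]; simp only [mul_assoc]
  rw [this n, hn, zero_mul, mul_zero]

end Quotient

/-! ### Minimal right ideals and minimal idempotents. -/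

section MinimalIdeal

variable {A : Type*} [Ring A]

/-- In a ring with zero Jacobson radical there are no nonzero right ideals of square zero. -/
theorem exists_mul_ne_zero_of_ne_bot (hA : Ring.jacobson A = ⊥) {J : Submodule Aᵐᵒᵖ A}
    (hJ : J ≠ ⊥) : ∃ x ∈ J, ∃ y ∈ J, x * y ≠ 0 := by
  by_contra! h
  refine hJ ((Submodule.eq_bot_iff _).mpr fun x hx => ?_)
  have : x ∈ Ideal.jacobson (⊥ : Ideal A) := by
    -- Since `(y * x) ^ 2 = 0`, the inverse of `1 + y * x` is `1 - y * x`.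
    refine Ideal.mem_jacobson_iff.mpr fun y => ⟨1 - y * x, ?_⟩
    have h0 : x * y * x = 0 := h _ (mul_right_mem hx y) _ hx
    rw [Ideal.mem_bot, show (1 - y * x) * y * x + (1 - y * x) - 1 = -(y * (x * y * x)) by
      noncomm_ring, h0, mul_zero, neg_zero]
  rwa [Ideal.jacobson_bot, hA, Ideal.mem_bot] at this

theorem mem_of_isAtom {J : Submodule Aᵐᵒᵖ A} (hJ : IsAtom J) {x : A} (hx : x ∈ J) (hx0 : x ≠ 0)
    {y : A} (hy : y ∈ J) : ∃ a, x * a = y := by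
  have hle : LinearMap.range (mulLeftHom x) ≤ J := by
    rintro _ ⟨a, rfl⟩
    exact mul_right_mem hx a
  rcases hJ.le_iff.mp hle with h | h
  · exact absurd ((Submodule.eq_bot_iff _).mp h x ⟨1, mul_one x⟩) hx0
  · rw [← h] at hy
    exact hy

/-- Brauer's lemma. -/
theorem exists_isIdempotentElem_of_isAtom (hA : Ring.jacobson A = ⊥) {J : Submodule Aᵐᵒᵖ A}
    (hJ : IsAtom J) : ∃ e ∈ J, e ≠ 0 ∧ e * e = e ∧ ∀ x ∈ J, e * x = x := by
  obtain ⟨x, hx, y, hy, hxy⟩ := exists_mul_ne_zero_of_ne_bot hA hJ.1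
  have hinj : ∀ z ∈ J, x * z = 0 → z = 0 := by
    intro z hz hxz
    by_contra hz0
    obtain ⟨a, rfl⟩ := mem_of_isAtom hJ hz hz0 hy
    rw [← mul_assoc, hxz, zero_mul] at hxy
    exact hxy rfl
  -- The idempotent is `y * a`: it satisfies `x * (y * a) = x`, and left multiplication by `x` is
  -- injective on `J`.
  obtain ⟨a, ha⟩ := mem_of_isAtom hJ (mul_right_mem hx y) hxy hx
  have he : y * a ∈ J := mul_right_mem hy a
  have hxe : x * (y * a) = x := by rw [← mul_assoc, ha]
  have hid : ∀ z ∈ J, y * a * z = z := fun z hz => by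
    rw [← sub_eq_zero]
    refine hinj _ (J.sub_mem (mul_right_mem he z) hz) ?_
    rw [mul_sub, ← mul_assoc x, hxe, sub_self]
  refine ⟨y * a, he, ?_, hid _ he, hid⟩
  intro h0
  rw [h0, mul_zero] at hxe
  rw [← hxe, zero_mul] at hxy
  exact hxy rfl

/-- `e` is a minimal idempotent: a nonzero idempotent that generates a minimal right ideal. -/
structure IsMinIdempotent (e : A) : Prop where
  ne_zero : e ≠ 0
  mul_self : e * e = e
  isAtom : IsAtom (LinearMap.range (mulLeftHom e))

theorem exists_isMinIdempotent_of_isAtom (hA : Ring.jacobson A = ⊥) {J : Submodule Aᵐᵒᵖ A}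
    (hJ : IsAtom J) : ∃ e, IsMinIdempotent e ∧ LinearMap.range (mulLeftHom e) = J := by
  obtain ⟨e, he, he0, hee, hid⟩ := exists_isIdempotentElem_of_isAtom hA hJ
  have : LinearMap.range (mulLeftHom e) = J := by
    refine le_antisymm ?_ fun x hx => ⟨x, hid x hx⟩
    rintro _ ⟨a, rfl⟩
    exact mul_right_mem he a
  exact ⟨e, ⟨he0, hee, this ▸ hJ⟩, this⟩

theorem IsMinIdempotent.exists_right_inv {e : A} (he : IsMinIdempotent e) {x : A}
    (hex : e * x = x) (hxe : x * e = x) (hx0 : x ≠ 0) :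
    ∃ y, e * y = y ∧ y * e = y ∧ x * y = e ∧ y ≠ 0 := by
  obtain ⟨a, ha⟩ := mem_of_isAtom he.isAtom ⟨x, hex⟩ hx0 ⟨e, he.mul_self⟩
  have h : x * (e * a * e) = e := by
    rw [← mul_assoc, ← mul_assoc, hxe, ha, he.mul_self]
  refine ⟨e * a * e, ?_, ?_, h, ?_⟩
  · rw [← mul_assoc, ← mul_assoc, he.mul_self]
  · rw [mul_assoc, he.mul_self]
  · intro h0
    rw [h0, mul_zero] at h
    exact he.ne_zero h.symm

/-- The corner `e A e` of a minimal idempotent is a division ring. -/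
theorem IsMinIdempotent.exists_inv {e : A} (he : IsMinIdempotent e) {x : A}
    (hex : e * x = x) (hxe : x * e = x) (hx0 : x ≠ 0) :
    ∃ y, e * y = y ∧ y * e = y ∧ x * y = e ∧ y * x = e := by
  obtain ⟨y, hey, hye, hxy, hy0⟩ := he.exists_right_inv hex hxe hx0
  obtain ⟨w, hew, -, hyw, -⟩ := he.exists_right_inv hey hye hy0
  refine ⟨y, hey, hye, hxy, ?_⟩
  have : x = w := by rw [← hxe, ← hyw, ← mul_assoc, hxy, hew]
  rw [this, hyw]

end MinimalIdeal

/-! ### The corner of a minimal idempotent and the spaces `J e`. -/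

section Corner

/-- The corner of a minimal idempotent of a complex Banach algebra is one-dimensional. -/
theorem IsMinIdempotent.exists_eq_smul {A : Type*} [NormedRing A] [NormedAlgebra ℂ A]
    [CompleteSpace A] {e : A} (he : IsMinIdempotent e) {x : A} (hex : e * x = x)
    (hxe : x * e = x) : ∃ c : ℂ, x = c • e := by
  by_contra! hx
  have hee := he.mul_self
  -- If `x` is no multiple of `e`, then `c • e - x` is invertible in the corner; adding `c⁻¹ • (1 -
  -- e)` to its inverse there inverts `c - x` in `A`. So `x` is quasinilpotent, yet invertible in
  -- the corner.
  have hspec : ∀ c ∈ spectrum ℂ x, c = 0 := by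
    intro c hc
    by_contra hc0
    obtain ⟨y, hey, hye, hxy, hyx⟩ := he.exists_inv (x := c • e - x)
      (by rw [mul_sub, mul_smul_comm, hee, hex]) (by rw [sub_mul, smul_mul_assoc, hee, hxe])
      (sub_ne_zero.mpr (hx c).symm)
    rw [sub_mul, smul_mul_assoc, hey] at hxy
    rw [mul_sub, mul_smul_comm, hye] at hyx
    refine spectrum.mem_iff.mp hc ⟨⟨algebraMap ℂ A c - x, y + c⁻¹ • (1 - e), ?_, ?_⟩, rfl⟩
    · rw [Algebra.algebraMap_eq_smul_one, sub_mul, smul_mul_assoc, one_mul, mul_add,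
        mul_smul_comm, mul_sub, mul_one, hxe, sub_self, smul_zero, add_zero, smul_add, smul_smul,
        mul_inv_cancel₀ hc0, one_smul, add_sub_right_comm, hxy, add_sub_cancel]
    · rw [Algebra.algebraMap_eq_smul_one, mul_sub, mul_smul_comm, mul_one, add_mul,
        smul_mul_assoc, sub_mul, one_mul, hex, sub_self, smul_zero, add_zero, smul_add, smul_smul,
        mul_inv_cancel₀ hc0, one_smul, add_sub_right_comm, hyx, add_sub_cancel]
  have hrad : spectralRadius ℂ x = 0 := by
    refine le_antisymm (iSup₂_le fun c hc => ?_) bot_le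
    simp [hspec c hc]
  have hx0 : x ≠ 0 := fun h => hx 0 (by rw [h, zero_smul])
  obtain ⟨y, -, -, hxy, hyx⟩ := he.exists_inv hex hxe hx0
  refine he.ne_zero ?_
  rw [← hxy]
  refine eq_zero_of_spectralRadius_eq_zero hrad (hxy.trans hyx.symm) ?_
  rw [hxy]
  exact hee

variable {A : Type*} [Ring A] [Algebra ℂ A]

theorem smul_mem_right (J : Submodule Aᵐᵒᵖ A) (c : ℂ) {x : A} (hx : x ∈ J) : c • x ∈ J := by
  rw [Algebra.smul_def, Algebra.commutes]
  exact mul_right_mem hx _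

/-- The complex vector space `J e = J ∩ A e`, for a right ideal `J` and an idempotent `e`. -/
def mulRightSpace (e : A) (J : Submodule Aᵐᵒᵖ A) : Submodule ℂ A where
  carrier := {x | x ∈ J ∧ x * e = x}
  add_mem' hx hy := ⟨J.add_mem hx.1 hy.1, by rw [add_mul, hx.2, hy.2]⟩
  zero_mem' := ⟨J.zero_mem, zero_mul e⟩
  smul_mem' c x hx := ⟨smul_mem_right J c hx.1, by rw [smul_mul_assoc, hx.2]⟩

theorem mulRightSpace_mono (e : A) {J K : Submodule Aᵐᵒᵖ A} (h : J ≤ K) :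
    mulRightSpace e J ≤ mulRightSpace e K := fun _ hx => ⟨h hx.1, hx.2⟩

theorem mulRightSpace_bot (e : A) : mulRightSpace e (⊥ : Submodule Aᵐᵒᵖ A) = ⊥ :=
  (Submodule.eq_bot_iff _).mpr fun _ hx => hx.1

theorem mul_mem_mulRightSpace {e : A} (he : e * e = e) {J : Submodule Aᵐᵒᵖ A} {x : A}
    (hx : x ∈ J) : x * e ∈ mulRightSpace e J :=
  ⟨mul_right_mem hx e, by rw [mul_assoc, he]⟩

theorem mulRightSpace_sup {e : A} (he : e * e = e) (J K : Submodule Aᵐᵒᵖ A) :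
    mulRightSpace e (J ⊔ K) = mulRightSpace e J ⊔ mulRightSpace e K := by
  refine le_antisymm ?_ (sup_le (mulRightSpace_mono e le_sup_left)
    (mulRightSpace_mono e le_sup_right))
  rintro x ⟨hx, hxe⟩
  obtain ⟨y, hy, z, hz, rfl⟩ := Submodule.mem_sup.mp hx
  rw [← hxe, add_mul]
  exact Submodule.add_mem_sup (mul_mem_mulRightSpace he hy) (mul_mem_mulRightSpace he hz)

theorem disjoint_mulRightSpace (e : A) {J K : Submodule Aᵐᵒᵖ A} (h : Disjoint J K) :
    Disjoint (mulRightSpace e J) (mulRightSpace e K) := by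
  rw [Submodule.disjoint_def] at h ⊢
  exact fun x hx hy => h x hx.1 hy.1

theorem mulRightSpace_eq_bot_iff {e : A} (he : e * e = e) {J : Submodule Aᵐᵒᵖ A} :
    mulRightSpace e J = ⊥ ↔ ∀ x ∈ J, x * e = 0 :=
  ⟨fun h x hx => (Submodule.eq_bot_iff _).mp h _ (mul_mem_mulRightSpace he hx),
    fun h => (Submodule.eq_bot_iff _).mpr fun x hx => by rw [← hx.2, h x hx.1]⟩

/-- A minimal right ideal `J` has `J e ≠ 0` exactly when it is isomorphic to `e A`. -/
theorem mulRightSpace_ne_bot_iff {e : A} (he : IsMinIdempotent e) {J : Submodule Aᵐᵒᵖ A}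
    (hJ : IsAtom J) :
    mulRightSpace e J ≠ ⊥ ↔ Nonempty (LinearMap.range (mulLeftHom e) ≃ₗ[Aᵐᵒᵖ] J) := by
  have : IsSimpleModule Aᵐᵒᵖ J := isSimpleModule_iff_isAtom.mpr hJ
  have : IsSimpleModule Aᵐᵒᵖ (LinearMap.range (mulLeftHom e)) :=
    isSimpleModule_iff_isAtom.mpr he.isAtom
  have hee : e ∈ LinearMap.range (mulLeftHom e) := ⟨e, he.mul_self⟩
  constructor
  · intro h
    obtain ⟨x, ⟨hx, hxe⟩, hx0⟩ := Submodule.exists_mem_ne_zero_of_ne_bot h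
    let φ : LinearMap.range (mulLeftHom e) →ₗ[Aᵐᵒᵖ] J :=
      ((mulLeftHom x).domRestrict _).codRestrict J fun y => mul_right_mem hx _
    have hφ : φ ≠ 0 := fun h0 => hx0 <| by
      have := congrArg Subtype.val (LinearMap.congr_fun h0 ⟨e, hee⟩)
      rw [← hxe]
      exact this
    exact ⟨LinearEquiv.ofBijective φ (LinearMap.bijective_of_ne_zero hφ)⟩
  · rintro ⟨φ⟩ h
    have h1 := (mulRightSpace_eq_bot_iff he.mul_self).mp h _ (φ ⟨e, hee⟩).2
    have h2 : φ (MulOpposite.op e • ⟨e, hee⟩) = 0 := by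
      rw [map_smul]
      exact Subtype.ext h1
    rw [LinearEquiv.map_eq_zero_iff] at h2
    exact he.ne_zero (he.mul_self.symm.trans (congrArg Subtype.val h2))

end Corner

/-! ### Dimension of `J e`. -/

section Rank

variable {A : Type*} [NormedRing A] [NormedAlgebra ℂ A] [CompleteSpace A]

/-- Any nonzero `x = x * e` in `J` generates `J`, so `J e = x (e A e)`, and the corner consists of
scalars. -/
theorem IsMinIdempotent.exists_mulRightSpace_le {e : A} (he : IsMinIdempotent e)
    {J : Submodule Aᵐᵒᵖ A} (hJ : IsAtom J) : ∃ x, mulRightSpace e J ≤ Submodule.span ℂ {x} := by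
  by_cases h : mulRightSpace e J = ⊥
  · exact ⟨0, h ▸ bot_le⟩
  obtain ⟨x, ⟨hx, hxe⟩, hx0⟩ := Submodule.exists_mem_ne_zero_of_ne_bot h
  refine ⟨x, fun y ⟨hy, hye⟩ => ?_⟩
  obtain ⟨a, rfl⟩ := mem_of_isAtom hJ hx hx0 hy
  obtain ⟨c, hc⟩ := he.exists_eq_smul (x := e * a * e)
    (by rw [← mul_assoc, ← mul_assoc, he.mul_self]) (by rw [mul_assoc, he.mul_self])
  refine Submodule.mem_span_singleton.mpr ⟨c, ?_⟩
  rw [← hye]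
  nth_rw 2 [← hxe]
  rw [mul_assoc x e a, mul_assoc x, hc, mul_smul_comm, hxe]

theorem IsMinIdempotent.finrank_mulRightSpace {e : A} (he : IsMinIdempotent e)
    {J : Submodule Aᵐᵒᵖ A} (hJ : IsAtom J) (h : mulRightSpace e J ≠ ⊥) :
    Module.finrank ℂ (mulRightSpace e J) = 1 := by
  obtain ⟨x, hx⟩ := he.exists_mulRightSpace_le hJ
  refine le_antisymm ((Submodule.finrank_mono hx).trans
    (by simpa using finrank_span_le_card (R := ℂ) ({x} : Set A))) ?_
  have : FiniteDimensional ℂ (mulRightSpace e J) := Submodule.finiteDimensional_of_le hx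
  exact Nat.one_le_iff_ne_zero.mpr fun h0 => h (Submodule.finrank_eq_zero.mp h0)

theorem IsMinIdempotent.finiteDimensional_mulRightSpace {e : A} (he : IsMinIdempotent e)
    (s : Finset (Submodule Aᵐᵒᵖ A)) (hs : ∀ I ∈ s, IsAtom I) :
    FiniteDimensional ℂ (mulRightSpace e (s.sup id)) := by
  classical
  induction s using Finset.induction_on with
  | empty => rw [Finset.sup_empty, mulRightSpace_bot]; infer_instance
  | insert I s _ ih =>
    rw [Finset.sup_insert, mulRightSpace_sup he.mul_self]
    have := ih fun I hI => hs I (Finset.mem_insert_of_mem hI)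
    obtain ⟨x, hx⟩ := he.exists_mulRightSpace_le (hs I (by simp))
    have : FiniteDimensional ℂ (mulRightSpace e (id I)) := Submodule.finiteDimensional_of_le hx
    exact Submodule.finiteDimensional_sup _ _

end Rank

/-! ### Isomorphism classes of minimal right ideals. -/

section IsoClasses

variable {A : Type*} [Ring A] [Algebra ℂ A]

/-- A finite set of minimal idempotents representing each isomorphism class of minimal right ideals
contained in `J₀` exactly once. -/
structure IsRepresentativeFamily (r : Finset A) (J₀ : Submodule Aᵐᵒᵖ A) : Prop where
  isMinIdempotent : ∀ e ∈ r, IsMinIdempotent e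
  exists_unique : ∀ K ≤ J₀, IsAtom K → ∃ e ∈ r, mulRightSpace e K ≠ ⊥ ∧
    ∀ e' ∈ r, mulRightSpace e' K ≠ ⊥ → e' = e

theorem exists_mulRightSpace_ne_bot {e : A} (he : IsMinIdempotent e)
    {s : Finset (Submodule Aᵐᵒᵖ A)} (h : e ∈ s.sup id) : ∃ I ∈ s, mulRightSpace e I ≠ ⊥ := by
  classical
  by_contra! hs
  have key : mulRightSpace e (s.sup id) = ⊥ := by
    clear h
    induction s using Finset.induction_on with
    | empty => rw [Finset.sup_empty, mulRightSpace_bot]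
    | insert I s _ ih =>
      rw [Finset.sup_insert, mulRightSpace_sup he.mul_self, id_eq, hs I (by simp),
        ih fun I hI => hs I (Finset.mem_insert_of_mem hI), sup_bot_eq]
  exact he.ne_zero ((Submodule.eq_bot_iff _).mp key e ⟨h, he.mul_self⟩)

/-- A minimal `K` inside the sum is generated by a minimal idempotent `e`, and some `I` in `s` has
`I e ≠ 0`. So `K` is isomorphic to a member of `s`, and finitely many classes suffice. -/
theorem exists_isRepresentativeFamily (hA : Ring.jacobson A = ⊥)
    (s : Finset (Submodule Aᵐᵒᵖ A)) (hs : ∀ I ∈ s, IsAtom I) :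
    ∃ r : Finset A, IsRepresentativeFamily r (s.sup id) := by
  classical
  let iso : Setoid {J : Submodule Aᵐᵒᵖ A // IsAtom J} :=
    { r := fun J K => Nonempty (J.1 ≃ₗ[Aᵐᵒᵖ] K.1)
      iseqv := ⟨fun _ => ⟨LinearEquiv.refl _ _⟩, fun ⟨φ⟩ => ⟨φ.symm⟩,
        fun ⟨φ⟩ ⟨ψ⟩ => ⟨φ.trans ψ⟩⟩ }
  choose g hg hgr using
    fun J : {J : Submodule Aᵐᵒᵖ A // IsAtom J} => exists_isMinIdempotent_of_isAtom hA J.2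
  let gen : Quotient iso → A := fun q => g q.out
  have hgen : ∀ (J : {J : Submodule Aᵐᵒᵖ A // IsAtom J}) (q : Quotient iso),
      mulRightSpace (gen q) J.1 ≠ ⊥ ↔ q = ⟦J⟧ := by
    intro J q
    rw [mulRightSpace_ne_bot_iff (hg _) J.2, hgr, eq_comm, Quotient.mk_eq_iff_out]
    exact ⟨fun ⟨φ⟩ => ⟨φ.symm⟩, fun ⟨φ⟩ => ⟨φ.symm⟩⟩
  refine ⟨s.attach.image fun I => gen ⟦⟨I.1, hs I.1 I.2⟩⟧, ?_, ?_⟩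
  · intro e he
    obtain ⟨I, -, rfl⟩ := Finset.mem_image.mp he
    exact hg _
  · intro K hK hKa
    obtain ⟨e, he, heK⟩ := exists_isMinIdempotent_of_isAtom hA hKa
    obtain ⟨I, hI, hIe⟩ := exists_mulRightSpace_ne_bot he
      (hK (heK ▸ ⟨e, he.mul_self⟩ : e ∈ K))
    rw [mulRightSpace_ne_bot_iff he (hs I hI), heK] at hIe
    have hKI : (⟦⟨K, hKa⟩⟧ : Quotient iso) = ⟦⟨I, hs I hI⟩⟧ := Quotient.sound hIe
    refine ⟨gen ⟦⟨K, hKa⟩⟧, ?_, (hgen ⟨K, hKa⟩ _).mpr rfl, fun e' he' h => ?_⟩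
    · rw [hKI]
      exact Finset.mem_image.mpr ⟨⟨I, hI⟩, Finset.mem_attach _ _, rfl⟩
    · obtain ⟨I', -, rfl⟩ := Finset.mem_image.mp he'
      rw [(hgen ⟨K, hKa⟩ _).mp h]

/-- The sum of the dimensions of the spaces `J e`, for `e` in `r`. -/
noncomputable def dimSum (r : Finset A) (J : Submodule Aᵐᵒᵖ A) : ℕ :=
  ∑ e ∈ r, Module.finrank ℂ (mulRightSpace e J)

theorem dimSum_bot (r : Finset A) : dimSum r (⊥ : Submodule Aᵐᵒᵖ A) = 0 :=
  Finset.sum_eq_zero fun e _ => by rw [mulRightSpace_bot, finrank_bot]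

end IsoClasses

/-! ### The order of a right ideal as a sum of dimensions. -/

section Rank

variable {A : Type*} [NormedRing A] [NormedAlgebra ℂ A] [CompleteSpace A]

namespace IsRepresentativeFamily

variable {r : Finset A} {s : Finset (Submodule Aᵐᵒᵖ A)}

theorem dimSum_of_isAtom {J₀ : Submodule Aᵐᵒᵖ A} (hr : IsRepresentativeFamily r J₀)
    {K : Submodule Aᵐᵒᵖ A} (hK : K ≤ J₀) (hKa : IsAtom K) : dimSum r K = 1 := by
  obtain ⟨e, he, heK, huniq⟩ := hr.exists_unique K hK hKa
  unfold dimSum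
  rw [Finset.sum_eq_single e, (hr.isMinIdempotent e he).finrank_mulRightSpace hKa heK]
  · intro e' he' hne
    by_contra h
    refine hne (huniq e' he' fun h0 => h ?_)
    rw [h0, finrank_bot]
  · exact fun h => absurd he h

theorem finiteDimensional (hr : IsRepresentativeFamily r (s.sup id)) (hs : ∀ I ∈ s, IsAtom I)
    {e : A} (he : e ∈ r) {J : Submodule Aᵐᵒᵖ A} (hJ : J ≤ s.sup id) :
    FiniteDimensional ℂ (mulRightSpace e J) :=
  have := (hr.isMinIdempotent e he).finiteDimensional_mulRightSpace s hs
  Submodule.finiteDimensional_of_le (mulRightSpace_mono e hJ)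

theorem dimSum_sup_of_disjoint (hr : IsRepresentativeFamily r (s.sup id))
    (hs : ∀ I ∈ s, IsAtom I) {J K : Submodule Aᵐᵒᵖ A} (hJ : J ≤ s.sup id) (hK : K ≤ s.sup id)
    (hJK : Disjoint J K) : dimSum r (J ⊔ K) = dimSum r J + dimSum r K := by
  unfold dimSum
  rw [← Finset.sum_add_distrib]
  refine Finset.sum_congr rfl fun e he => ?_
  have := hr.finiteDimensional hs he hJ
  have := hr.finiteDimensional hs he hK
  rw [← Submodule.finrank_sup_add_finrank_inf_eq, (disjoint_mulRightSpace e hJK).eq_bot,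
    finrank_bot, add_zero, mulRightSpace_sup (hr.isMinIdempotent e he).mul_self]

theorem dimSum_sup_le (hr : IsRepresentativeFamily r (s.sup id))
    (hs : ∀ I ∈ s, IsAtom I) {J K : Submodule Aᵐᵒᵖ A} (hJ : J ≤ s.sup id) (hK : K ≤ s.sup id) :
    dimSum r (J ⊔ K) ≤ dimSum r J + dimSum r K := by
  unfold dimSum
  rw [← Finset.sum_add_distrib]
  refine Finset.sum_le_sum fun e he => ?_
  have := hr.finiteDimensional hs he hJ
  have := hr.finiteDimensional hs he hK
  rw [mulRightSpace_sup (hr.isMinIdempotent e he).mul_self]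
  exact Submodule.finrank_add_le_finrank_add_finrank _ _

theorem dimSum_finset_sup_le (hr : IsRepresentativeFamily r (s.sup id))
    (hs : ∀ I ∈ s, IsAtom I) (t : Finset (Submodule Aᵐᵒᵖ A)) (ht : ∀ I ∈ t, IsAtom I)
    (hts : t.sup id ≤ s.sup id) : dimSum r (t.sup id) ≤ t.card := by
  classical
  induction t using Finset.induction_on with
  | empty => rw [Finset.sup_empty, dimSum_bot]; exact Nat.zero_le _
  | insert I t hI ih =>
    rw [Finset.sup_insert, id_eq] at hts ⊢
    rw [Finset.card_insert_of_notMem hI]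
    have h1 := le_sup_left.trans hts
    have h2 := le_sup_right.trans hts
    have := ih (fun K hK => ht K (Finset.mem_insert_of_mem hK)) h2
    have h3 := hr.dimSum_sup_le hs h1 h2
    rw [hr.dimSum_of_isAtom h1 (ht I (by simp))] at h3
    omega

/-- Peirce decomposition: a minimal `I = e A` inside `J` splits off with complement `{x ∈ J | e * x
= 0}`, and `dimSum` drops by one. -/
theorem exists_finset_card_eq_dimSum (hA : Ring.jacobson A = ⊥)
    (hr : IsRepresentativeFamily r (s.sup id)) (hs : ∀ I ∈ s, IsAtom I)
    {J : Submodule Aᵐᵒᵖ A} (hJ : J ≤ s.sup id) :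
    ∃ t : Finset (Submodule Aᵐᵒᵖ A), (∀ I ∈ t, IsAtom I) ∧ t.sup id = J ∧ t.card = dimSum r J := by
  classical
  obtain ⟨h1, -⟩ := isArtinian_and_isNoetherian_finset_sup s hs
  have hatom : ∀ K ≤ s.sup id, K ≠ ⊥ → ∃ I ≤ K, IsAtom I := by
    intro K hK hK0
    have : IsArtinian Aᵐᵒᵖ K := isArtinian_of_le hK
    have : Nontrivial K := Submodule.nontrivial_iff_ne_bot.mpr hK0
    obtain ⟨I, hI, -⟩ :=
      (eq_bot_or_exists_atom_le (⊤ : Submodule Aᵐᵒᵖ K)).resolve_left top_ne_bot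
    exact ⟨(Submodule.mapIic K I).1, (Submodule.mapIic K I).2,
      IsAtom.of_isAtom_coe_Iic (((Submodule.mapIic K).isAtom_iff I).mpr hI)⟩
  induction hn : dimSum r J using Nat.strong_induction_on generalizing J with
  | _ n ih =>
  by_cases hJ0 : J = ⊥
  · subst hJ0
    exact ⟨∅, by simp, by simp, by rw [← hn, dimSum_bot, Finset.card_empty]⟩
  obtain ⟨I, hIJ, hI⟩ := hatom J hJ hJ0
  obtain ⟨e, heI, -, hee, hid⟩ := exists_isIdempotentElem_of_isAtom hA hI
  set K : Submodule Aᵐᵒᵖ A := J ⊓ rightAnnihilator e with hK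
  have hKJ : K ≤ J := inf_le_left
  have hdisj : Disjoint I K := by
    rw [Submodule.disjoint_def]
    intro x hx hxK
    rw [← hid x hx]
    exact hxK.2
  have hsup : I ⊔ K = J := by
    refine le_antisymm (sup_le hIJ hKJ) fun x hx => ?_
    have h2 : x - e * x ∈ K := by
      refine ⟨J.sub_mem hx (mul_right_mem (hIJ heI) x), ?_⟩
      change e * (x - e * x) = 0
      rw [mul_sub, ← mul_assoc, hee, sub_self]
    rw [← add_sub_cancel (e * x) x]
    exact Submodule.add_mem_sup (mul_right_mem heI x) h2
  have hdim := hr.dimSum_sup_of_disjoint hs (hIJ.trans hJ) (hKJ.trans hJ) hdisj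
  rw [hsup, hr.dimSum_of_isAtom (hIJ.trans hJ) hI, hn] at hdim
  obtain ⟨t, ht, htK, hcard⟩ := ih (dimSum r K) (by omega) (hKJ.trans hJ) rfl
  have hIt : I ∉ t := fun h => hI.1 <| by
    rw [← disjoint_self]
    exact hdisj.mono_right (htK ▸ Finset.le_sup (f := id) h)
  refine ⟨insert I t, ?_, ?_, ?_⟩
  · simpa [hI] using ht
  · rw [Finset.sup_insert, htK, id_eq, hsup]
  · rw [Finset.card_insert_of_notMem hIt, hcard, hdim, add_comm]

/-- Splitting off minimal ideals attains `dimSum`; no shorter sum exists, because `dimSum` is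
subadditive and equals 1 on minimal ideals. -/
theorem rightOrder_eq_dimSum (hA : Ring.jacobson A = ⊥)
    (hr : IsRepresentativeFamily r (s.sup id)) (hs : ∀ I ∈ s, IsAtom I)
    {J : Submodule Aᵐᵒᵖ A} (hJ : J ≤ s.sup id) : rightOrder J = dimSum r J := by
  refine le_antisymm ?_ (le_sInf ?_)
  · obtain ⟨t, ht, htJ, hcard⟩ := hr.exists_finset_card_eq_dimSum hA hs hJ
    exact sInf_le ⟨t, ht, htJ, by rw [hcard]⟩
  · rintro _ ⟨t, ht, rfl, rfl⟩
    exact_mod_cast hr.dimSum_finset_sup_le hs t ht hJ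

end IsRepresentativeFamily

end Rank

/-! ### Traces of left multiplication and generalized eigenspaces. -/

section Trace

/-- The trace of an endomorphism of a finite-dimensional complex vector space is the sum of its
eigenvalues, counted with algebraic multiplicity. -/
theorem trace_eq_sum_finrank_maxGenEigenspace {V : Type*} [AddCommGroup V] [Module ℂ V]
    [FiniteDimensional ℂ V] (T : Module.End ℂ V) (Z : Finset ℂ)
    (hZ : ∀ z, Module.finrank ℂ (T.maxGenEigenspace z) ≠ 0 → z ∈ Z) :
    LinearMap.trace ℂ V T = ∑ z ∈ Z, z * (Module.finrank ℂ (T.maxGenEigenspace z) : ℂ) := by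
  classical
  rw [Module.End.trace_eq_sum_roots_charpoly_of_splits (IsAlgClosed.splits _),
    Finset.sum_multiset_count]
  simp_rw [LinearMap.finrank_maxGenEigenspace_eq] at hZ ⊢
  refine Finset.sum_subset_zero_on_sdiff ?_ ?_ ?_
  · intro z hz
    refine hZ z ?_
    rw [← Polynomial.count_roots]
    exact (Multiset.count_pos.mpr (Multiset.mem_toFinset.mp hz)).ne'
  · intro z hz
    have : z ∉ T.charpoly.roots := fun h => (Finset.mem_sdiff.mp hz).2 (Multiset.mem_toFinset.mpr h)
    rw [← Polynomial.count_roots, Multiset.count_eq_zero_of_notMem this, Nat.cast_zero, mul_zero]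
  · intro z _
    rw [Polynomial.count_roots, nsmul_eq_mul, mul_comm]

variable {A : Type*} [Ring A] [Algebra ℂ A]

/-- Left multiplication by `a`, as a map from `J e` to `K e`. -/
def mulLeftRestrict (e a : A) (J K : Submodule Aᵐᵒᵖ A) (h : ∀ x ∈ J, a * x ∈ K) :
    mulRightSpace e J →ₗ[ℂ] mulRightSpace e K :=
  (LinearMap.mulLeft ℂ a).restrict fun x hx => ⟨h x hx.1, by
    rw [LinearMap.mulLeft_apply, mul_assoc, hx.2]⟩

/-- The commutator of `a` with an element `b` that has finite rank on `A e` has trace zero there. -/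
theorem trace_mulLeftRestrict_commutator {a b e : A} {J : Submodule Aᵐᵒᵖ A}
    [FiniteDimensional ℂ (mulRightSpace e J)] (hb : b ∈ J) (hab : a * b ∈ J)
    (h : ∀ x ∈ J, (a * b - b * a) * x ∈ J) :
    LinearMap.trace ℂ _ (mulLeftRestrict e (a * b - b * a) J J h) = 0 := by
  -- Left multiplication by `a` need not preserve `J`, so both products are factored through `K = b
  -- A`; in the reverse order both factorizations become multiplication by `b * a` on `K e`.
  set K : Submodule Aᵐᵒᵖ A := LinearMap.range (mulLeftHom b)
  have hKJ : K ≤ J := by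
    rintro _ ⟨x, rfl⟩
    exact mul_right_mem hb x
  have : FiniteDimensional ℂ (mulRightSpace e K) :=
    Submodule.finiteDimensional_of_le (mulRightSpace_mono e hKJ)
  let α := mulLeftRestrict e b J K fun x _ => ⟨x, rfl⟩
  let β := mulLeftRestrict e a K J <| by
    rintro _ ⟨x, rfl⟩
    rw [mulLeftHom_apply, ← mul_assoc]
    exact mul_right_mem hab x
  let γ := mulLeftRestrict e (b * a) J K fun x _ => ⟨a * x, (mul_assoc b a x).symm⟩
  let ι := mulLeftRestrict e 1 K J fun x hx => by rw [one_mul]; exact hKJ hx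
  have h1 : mulLeftRestrict e (a * b - b * a) J J h = β ∘ₗ α - ι ∘ₗ γ := by
    refine LinearMap.ext fun x => Subtype.ext ?_
    change (a * b - b * a) * x.1 = a * (b * x.1) - 1 * (b * a * x.1)
    rw [sub_mul, mul_assoc a, one_mul]
  have h2 : α ∘ₗ β = γ ∘ₗ ι := by
    refine LinearMap.ext fun x => Subtype.ext ?_
    change b * (a * x.1) = b * a * (1 * x.1)
    rw [one_mul, mul_assoc]
  rw [h1]
  refine (map_sub (LinearMap.trace ℂ _) (β ∘ₗ α) (ι ∘ₗ γ)).trans ?_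
  rw [LinearMap.trace_comp_comm' α β, LinearMap.trace_comp_comm' γ ι, h2, sub_self]

/-- The generalized null right ideal `{x | (a - z) ^ k * x = 0 for some k}`. -/
def genNullIdeal (z : ℂ) (a : A) : Submodule Aᵐᵒᵖ A :=
  ⨆ k : ℕ, rightAnnihilator ((a - algebraMap ℂ A z) ^ k)

theorem mem_genNullIdeal {z : ℂ} {a x : A} :
    x ∈ genNullIdeal z a ↔ ∃ k : ℕ, (a - algebraMap ℂ A z) ^ k * x = 0 := by
  unfold genNullIdeal
  rw [Submodule.mem_iSup_of_directed]
  · rfl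
  · refine Monotone.directed_le (monotone_nat_of_le_succ fun k x hx => ?_)
    change (a - algebraMap ℂ A z) ^ (k + 1) * x = 0
    rw [pow_succ', mul_assoc, show (a - algebraMap ℂ A z) ^ k * x = 0 from hx, mul_zero]

/-- Induction on the exponent: `z x = a x - (a - z) x` with both terms in `J`, and `z` is
invertible. -/
theorem genNullIdeal_le {z : ℂ} (hz : z ≠ 0) {a : A} {J : Submodule Aᵐᵒᵖ A} (ha : a ∈ J) :
    genNullIdeal z a ≤ J := by
  intro x hx
  obtain ⟨k, hk⟩ := mem_genNullIdeal.mp hx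
  clear hx
  induction k generalizing x with
  | zero => rw [pow_zero, one_mul] at hk; exact hk ▸ J.zero_mem
  | succ k ih =>
    have h := ih (x := (a - algebraMap ℂ A z) * x) (by rw [← mul_assoc, ← pow_succ, hk])
    rw [sub_mul, ← Algebra.smul_def] at h
    have h2 := smul_mem_right J z⁻¹ (J.sub_mem (mul_right_mem ha x) h)
    rwa [sub_sub_cancel, smul_smul, inv_mul_cancel₀ hz, one_smul] at h2

theorem mem_spectrum_of_genNullIdeal_ne_bot {z : ℂ} {a : A} (h : genNullIdeal z a ≠ ⊥) :
    z ∈ spectrum ℂ a := by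
  rw [spectrum.mem_iff]
  intro hu
  have hu' : IsUnit (a - algebraMap ℂ A z) := by rw [← neg_sub]; exact hu.neg
  refine h ((Submodule.eq_bot_iff _).mpr fun x hx => ?_)
  obtain ⟨k, hk⟩ := mem_genNullIdeal.mp hx
  exact (hu'.pow k).mul_right_eq_zero.mp hk

/-- For `z ≠ 0` the ideal `J` contains the whole generalized null ideal, so restricting to `J e`
loses no generalized eigenvectors. -/
theorem finrank_maxGenEigenspace_mulLeftRestrict {z : ℂ} (hz : z ≠ 0) {a e : A}
    {J : Submodule Aᵐᵒᵖ A} (ha : a ∈ J) (h : ∀ x ∈ J, a * x ∈ J) :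
    Module.finrank ℂ (Module.End.maxGenEigenspace (mulLeftRestrict e a J J h) z) =
      Module.finrank ℂ (mulRightSpace e (genNullIdeal z a)) := by
  set T : Module.End ℂ (mulRightSpace e J) := mulLeftRestrict e a J J h with hT
  have hpow : ∀ (k : ℕ) (x : mulRightSpace e J),
      (((T - z • 1) ^ k) x : A) = (a - algebraMap ℂ A z) ^ k * x := by
    intro k
    induction k with
    | zero => simp
    | succ k ih =>
      intro x
      rw [pow_succ, Module.End.mul_apply, ih, pow_succ, mul_assoc]
      congr 1
      rw [sub_mul, ← Algebra.smul_def]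
      rfl
  have : (Module.End.maxGenEigenspace T z).map (mulRightSpace e J).subtype =
      mulRightSpace e (genNullIdeal z a) := by
    ext x
    rw [Submodule.mem_map]
    constructor
    · rintro ⟨y, hy, rfl⟩
      obtain ⟨k, hk⟩ := (Module.End.mem_maxGenEigenspace _ _ _).mp hy
      refine ⟨mem_genNullIdeal.mpr ⟨k, ?_⟩, y.2.2⟩
      exact (hpow k y).symm.trans (congrArg Subtype.val hk)
    · rintro ⟨hx, hxe⟩
      refine ⟨⟨x, genNullIdeal_le hz ha hx, hxe⟩, ?_, rfl⟩
      obtain ⟨k, hk⟩ := mem_genNullIdeal.mp hx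
      refine (Module.End.mem_maxGenEigenspace _ _ _).mpr ⟨k, Subtype.ext ?_⟩
      rw [hpow, hk]
      rfl
  rw [← this]
  exact (LinearEquiv.finrank_eq (Submodule.equivMapOfInjective _
    (Submodule.injective_subtype _) _))

end Trace

/-! ### The trace on the socle and the index. -/

section SocTrace

variable {A : Type*} [NormedRing A] [NormedAlgebra ℂ A] [CompleteSpace A]

/-- The trace on the socle is the sum of the traces of left multiplication on the spaces `J e`. -/
theorem socTrace_eq_sum_trace (hA : Ring.jacobson A = ⊥) {r : Finset A}
    {s : Finset (Submodule Aᵐᵒᵖ A)} (hr : IsRepresentativeFamily r (s.sup id))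
    (hs : ∀ I ∈ s, IsAtom I) {a : A} (ha : a ∈ s.sup id) (h : ∀ x ∈ s.sup id, a * x ∈ s.sup id) :
    socTrace a =
      ∑ e ∈ r, LinearMap.trace ℂ _ (mulLeftRestrict e a (s.sup id) (s.sup id) h) := by
  classical
  set T : ∀ e, Module.End ℂ (mulRightSpace e (s.sup id)) :=
    fun e => mulLeftRestrict e a (s.sup id) (s.sup id) h with hT
  have hfin : ∀ e ∈ r, FiniteDimensional ℂ (mulRightSpace e (s.sup id)) :=
    fun e he => hr.finiteDimensional hs he le_rfl
  have hmult : ∀ z ≠ 0, (algMultiplicity z a).toNat = dimSum r (genNullIdeal z a) := by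
    intro z hz
    change (rightOrder (genNullIdeal z a)).toNat = _
    rw [hr.rightOrder_eq_dimSum hA hs (genNullIdeal_le hz ha), ENat.toNat_natCast]
  have hroots : ∀ e ∈ r, ∃ Y : Finset ℂ,
      ∀ z, Module.finrank ℂ ((T e).maxGenEigenspace z) ≠ 0 → z ∈ Y := by
    intro e he
    have := hfin e he
    refine ⟨(T e).charpoly.roots.toFinset, fun z hz => ?_⟩
    rw [LinearMap.finrank_maxGenEigenspace_eq, ← Polynomial.count_roots] at hz
    exact Multiset.mem_toFinset.mpr (Multiset.count_ne_zero.mp hz)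
  choose! Y hY using hroots
  set Z : Finset ℂ := r.biUnion Y
  have hZ : ∀ e ∈ r, ∀ z, Module.finrank ℂ ((T e).maxGenEigenspace z) ≠ 0 → z ∈ Z :=
    fun e he z hz => Finset.mem_biUnion.mpr ⟨e, he, hY e he z hz⟩
  have hsum : socTrace a = ∑ z ∈ Z, z * ((algMultiplicity z a).toNat : ℂ) := by
    -- `Z` and the spectrum may differ, but only where the summand vanishes: a nonzero summand puts
    -- `z` in both.
    refine finsum_mem_eq_sum_of_inter_support_eq _ ?_
    ext z
    simp only [Set.mem_inter_iff, Function.mem_support, and_congr_left_iff]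
    intro hz
    have hz0 : z ≠ 0 := left_ne_zero_of_mul hz
    have hm : dimSum r (genNullIdeal z a) ≠ 0 := by
      rw [← hmult z hz0]
      exact_mod_cast right_ne_zero_of_mul hz
    refine iff_of_true (mem_spectrum_of_genNullIdeal_ne_bot fun h0 => hm ?_) ?_
    · rw [h0, dimSum_bot]
    · obtain ⟨e, he, hne⟩ := Finset.exists_ne_zero_of_sum_ne_zero hm
      exact hZ e he z (by rwa [finrank_maxGenEigenspace_mulLeftRestrict hz0 ha h])
  have htrace : ∀ e ∈ r, LinearMap.trace ℂ _ (T e) =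
      ∑ z ∈ Z, z * (Module.finrank ℂ (mulRightSpace e (genNullIdeal z a)) : ℂ) := by
    intro e he
    have := hfin e he
    rw [trace_eq_sum_finrank_maxGenEigenspace (T e) Z (hZ e he)]
    refine Finset.sum_congr rfl fun z _ => ?_
    by_cases hz : z = 0
    · rw [hz, zero_mul, zero_mul]
    · rw [finrank_maxGenEigenspace_mulLeftRestrict hz ha h]
  rw [hsum, Finset.sum_congr rfl htrace, Finset.sum_comm]
  refine Finset.sum_congr rfl fun z _ => ?_
  by_cases hz : z = 0
  · simp [hz]
  · rw [hmult z hz, dimSum, Nat.cast_sum, Finset.mul_sum]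

/-- The commutator of an element of the algebra with an element of the socle has trace zero. -/
theorem socTrace_commutator (hA : Ring.jacobson A = ⊥) (a : A) {b : A} (hb : b ∈ soc A) :
    socTrace (a * b - b * a) = 0 := by
  classical
  obtain ⟨s₁, hs₁, hbs⟩ := exists_finset_of_mem_soc hb
  obtain ⟨s₂, hs₂, habs⟩ := exists_finset_of_mem_soc ((soc A).mul_mem_left a hb)
  -- One finite sum must contain both `b` and `a * b`.
  have hs : ∀ I ∈ s₁ ∪ s₂, IsAtom I := fun I hI =>
    (Finset.mem_union.mp hI).elim (hs₁ I) (hs₂ I)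
  have hb' : b ∈ (s₁ ∪ s₂).sup id := by
    exact (Finset.sup_mono Finset.subset_union_left : s₁.sup id ≤ _) hbs
  have hab' : a * b ∈ (s₁ ∪ s₂).sup id := by
    exact (Finset.sup_mono Finset.subset_union_right : s₂.sup id ≤ _) habs
  obtain ⟨r, hr⟩ := exists_isRepresentativeFamily hA (s₁ ∪ s₂) hs
  have ht : a * b - b * a ∈ (s₁ ∪ s₂).sup id := Submodule.sub_mem _ hab' (mul_right_mem hb' a)
  rw [socTrace_eq_sum_trace hA hr hs ht fun x _ => mul_right_mem ht x]
  refine Finset.sum_eq_zero fun e he => ?_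
  have := hr.finiteDimensional hs he le_rfl
  exact trace_mulLeftRestrict_commutator hb' hab' _

theorem isBWeyl_of_pow_mem_soc (hA : Ring.jacobson A = ⊥) {f : A} {n : ℕ}
    (hf : f ^ n ∈ soc A) : IsBWeyl f := by
  refine ⟨(isDrazinInvertible_of_pow_mem_soc hf).isBFredholm, fun g hg => ?_⟩
  refine socTrace_commutator hA f (Ideal.Quotient.eq_zero_iff_mem.mp ?_)
  refine hg.eq_zero_of_pow_eq_zero (n := n) ?_
  rw [← map_pow, Ideal.Quotient.eq_zero_iff_mem.mpr hf]

end SocTrace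

theorem theorem7p2 {A : Type*} [NormedRing A] [NormedAlgebra ℂ A] [CompleteSpace A]
    (hA : Ring.jacobson A = ⊥) (f : A) :
    List.TFAE [
      ∃ n : ℕ, f ^ n ∈ soc A,
      IsRiesz f ∧ IsDrazinInvertible f,
      IsRiesz f ∧ IsBWeyl f,
      IsRiesz f ∧ IsBFredholm f] := by
  tfae_have 1 → 2 := fun ⟨_, hn⟩ =>
    ⟨isRiesz_of_pow_mem_soc hn, isDrazinInvertible_of_pow_mem_soc hn⟩
  tfae_have 1 → 3 := fun ⟨_, hn⟩ => ⟨isRiesz_of_pow_mem_soc hn, isBWeyl_of_pow_mem_soc hA hn⟩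
  tfae_have 2 → 4 := fun ⟨h1, h2⟩ => ⟨h1, h2.isBFredholm⟩
  tfae_have 3 → 4 := fun ⟨h1, h2⟩ => ⟨h1, h2.1⟩
  tfae_have 4 → 1 := fun ⟨h1, h2⟩ => pow_mem_soc_of_isRiesz_of_isBFredholm h1 h2
  tfae_finish
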